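/- For $\rho_1,\rho_2\in(-1,1)$ and an integer $k\ge 1$ let $\boldsymbol\Sigma_{\rho_2}^{[k,z]}$ be the $k\times k$ matrix with unit diagonal and off-diagonal entries $\rho_2$ if $z=1$, and $\rho_2^{|i-j|}$ if $z=2$; let $$\boldsymbol\Sigma_{\rho_1,\rho_2}^{[k,z]}=\begin{pmatrix}1&\rho_1\boldsymbol 1_k^{\mathrm T}\\ \rho_1\boldsymbol 1_k&\boldsymbol\Sigma_{\rho_2}^{[k,z]}\end{pmatrix}.$$ Let $z\in\{1,2\}$. If $z=1$, assume $\rho_1^2<\rho_2<1$; if $z=2$, assume that $\boldsymbol\Sigma_{\rho_1,\rho_2}^{[k,2]}$ is positive definite. Let $\Phi$ be the standard normal distribution function, with $\Phi(-\infty)=0$, $\Phi(\infty)=1$, $\Phi^{-1}(0)=-\infty$, $\Phi^{-1}(1)=\infty$. For a positive definite $d\times d$ correlation matrix $\boldsymbol\Sigma$ let $C_{\boldsymbol\Sigma}(u)=\mathbb P\big(Z_i\le\Phi^{-1}(u_i),\ i=1,\dots,d\big)$, $Z\sim \mathrm N(\boldsymbol 0,\boldsymbol\Sigma)$, be the Gaussian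 copula and, for $u\in(0,1)^d$ and $q=(\Phi^{-1}(u_1),\dots,\Phi^{-1}(u_d))^{\mathrm T}$, let $$c_{\boldsymbol\Sigma}(u)=\frac{(2\pi)^{-d/2}\det(\boldsymbol\Sigma)^{-1/2}\exp\left(-\tfrac12 q^{\mathrm T}\boldsymbol\Sigma^{-1}q\right)}{\prod_{i=1}^d (2\pi)^{-1/2}\exp(-q_i^2/2)}$$ be its density. Let $N^+$ be a non-degenerate positive integer-valued random variable with distribution function $F_1^+$ and probability mass function $f_1^+$, let $F_2$ be the distribution function of a distribution on $[0,\infty)$ with probability density function $f_2$, and let $\boldsymbol Y^{[k]}=(Y_1,\dots,Y_k)$ be random variables such that $(N^+,\boldsymbol Y^{[k]})$ has the joint distribution function $C_{\boldsymbol\Sigma_{\rho_1,\rho_2}^{[k,z]}}(F_1^+,F_2,\dots,F_2)$. Put $$\mu_{[k,z]}=\mu_{[k,z]}(\boldsymbol y)=\rho_1\boldsymbol 1_k^{\mathrm T}\big(\boldsymbol\Sigma_{\rho_2}^{[k,z]}\big)^{-1}\big(\Phi^{-1}(F_2(y_1)),\dots,\Phi^{-1}(F_2(y_k))\big)^{\mathrm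 T},\qquad \sigma_{[k,z]}=\sqrt{1-\rho_1\boldsymbol 1_k^{\mathrm T}\big(\boldsymbol\Sigma_{\rho_2}^{[k,z]}\big)^{-1}\rho_1\boldsymbol 1_k}.$$ Then $\boldsymbol\Sigma_{\rho_2}^{[k,z]}$ is positive definite, $\sigma_{[k,z]}>0$, and: (i) The joint density of $(N^+,\boldsymbol Y^{[k]})$ with respect to the product of the counting measure on $\mathbb Z$ and Lebesgue measure on $\mathbb R^k$ is $$h_{N^+,\boldsymbol Y^{[k]}}(n,\boldsymbol y)=f_{\boldsymbol Y^{[k]}}(\boldsymbol y)\left(\Phi\Big(\frac{\Phi^{-1}(F_1^+(n))-\mu_{[k,z]}}{\sigma_{[k,z]}}\Big)-\Phi\Big(\frac{\Phi^{-1}(F_1^+(n-1))-\mu_{[k,z]}}{\sigma_{[k,z]}}\Big)\right),\qquad n\in\mathbb Z,\ \boldsymbol y\in\mathbb R^k,$$ where $$f_{\boldsymbol Y^{[k]}}(\boldsymbol y)=c_{\boldsymbol\Sigma_{\rho_2}^{[k,z]}}(F_2(y_1),\dots,F_2(y_k))\prod_{i=1}^k f_2(y_i)$$ is the probability density function of $\boldsymbol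 Y^{[k]}$, whose distribution function is $C_{\boldsymbol\Sigma_{\rho_2}^{[k,z]}}(F_2,\dots,F_2)$. (Points $\boldsymbol y$ with some $F_2(y_i)\in\{0,1\}$ do not matter, since $f_2=0$ almost everywhere on $\{F_2\in\{0,1\}\}$.) (ii) For every $n$ with $f_1^+(n)>0$, the conditional density of $\boldsymbol Y^{[k]}$ given $N^+=n$ is $$h_{\boldsymbol Y^{[k]}|N^+}(\boldsymbol y\,|\,n)=\frac{f_{\boldsymbol Y^{[k]}}(\boldsymbol y)}{f_1^+(n)}\left(\Phi\Big(\frac{\Phi^{-1}(F_1^+(n))-\mu_{[k,z]}}{\sigma_{[k,z]}}\Big)-\Phi\Big(\frac{\Phi^{-1}(F_1^+(n-1))-\mu_{[k,z]}}{\sigma_{[k,z]}}\Big)\right).$$ -/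

import Mathlib

open MeasureTheory ProbabilityTheory Matrix

noncomputable section

/-- The two correlation structures among severities: `equi` is the equicorrelation structure
(`z = 1`), `autoreg` is the autoregressive structure (`z = 2`). -/
inductive CorrStructure
  | equi
  | autoreg

/-- The `k × k` correlation matrix `Σ_{ρ₂}^{[k,z]}` of the severities. -/
def severityCorr (z : CorrStructure) (k : ℕ) (ρ₂ : ℝ) : Matrix (Fin k) (Fin k) ℝ :=
  Matrix.of fun i j =>
    if i = j then 1
    else match z with
      | .equi => ρ₂
      | .autoreg => ρ₂ ^ ((i : ℤ) - (j : ℤ)).natAbs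

/-- The `(k+1) × (k+1)` correlation matrix `Σ_{ρ₁,ρ₂}^{[k,z]}`, in block form.  The index
`Sum.inl ()` is the frequency coordinate, `Sum.inr i` is the `i`-th severity coordinate. -/
def jointCorr (z : CorrStructure) (k : ℕ) (ρ₁ ρ₂ : ℝ) :
    Matrix (Unit ⊕ Fin k) (Unit ⊕ Fin k) ℝ :=
  Matrix.fromBlocks (Matrix.of fun _ _ => 1) (Matrix.of fun _ _ => ρ₁)
    (Matrix.of fun _ _ => ρ₁) (severityCorr z k ρ₂)

/-- Admissible parameters: `ρ₁² < ρ₂ < 1` for the equicorrelation structure; any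
`ρ₁, ρ₂ ∈ (-1,1)` for which the joint correlation matrix is positive definite for the
autoregressive structure. -/
def AdmissibleCorr (z : CorrStructure) (k : ℕ) (ρ₁ ρ₂ : ℝ) : Prop :=
  ρ₁ ∈ Set.Ioo (-1 : ℝ) 1 ∧ ρ₂ ∈ Set.Ioo (-1 : ℝ) 1 ∧
    match z with
    | .equi => ρ₁ ^ 2 < ρ₂
    | .autoreg => (jointCorr .autoreg k ρ₁ ρ₂).PosDef

/-- The standard normal distribution function, extended by `Φ(-∞) = 0` and `Φ(∞) = 1`. -/
def stdNormalCDF (x : EReal) : ℝ :=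
  (gaussianReal 0 1).real {t : ℝ | (t : EReal) ≤ x}

/-- The standard normal quantile function `Φ⁻¹` with values in the extended reals;
`Φ⁻¹(0) = -∞` and `Φ⁻¹(1) = ∞`. -/
def stdNormalQuantile (u : ℝ) : EReal :=
  sInf {x : EReal | u ≤ stdNormalCDF x}

/-- The Gaussian copula `C_S(u) = Φ_S(Φ⁻¹(u_1), …, Φ⁻¹(u_d))`, where `Φ_S` is the joint
distribution function of the centred Gaussian vector with correlation matrix `S`. -/
def gaussianCopula {ι : Type*} [Fintype ι] [DecidableEq ι] (S : Matrix ι ι ℝ) (u : ι → ℝ) : ℝ :=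
  (multivariateGaussian (0 : EuclideanSpace ℝ ι) S).real
    {x | ∀ i, ((x i : ℝ) : EReal) ≤ stdNormalQuantile (u i)}

/-- The density of the centred Gaussian vector with positive definite covariance matrix `S`. -/
def gaussianVectorPDF {ι : Type*} [Fintype ι] [DecidableEq ι] (S : Matrix ι ι ℝ)
    (x : ι → ℝ) : ℝ :=
  (Real.sqrt ((2 * Real.pi) ^ Fintype.card ι * S.det))⁻¹ *
    Real.exp (-(x ⬝ᵥ (S⁻¹ *ᵥ x)) / 2)

/-- The vector `(Φ⁻¹(u_1), …, Φ⁻¹(u_d))` as a real vector, for `u ∈ (0,1)^d`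
(infinite coordinates are replaced by `0`). -/
def quantileVector {ι : Type*} (u : ι → ℝ) : ι → ℝ :=
  fun i => (stdNormalQuantile (u i)).toReal

/-- The density `c_S` of the Gaussian copula on `(0,1)^d`: the ratio of the Gaussian density with
correlation matrix `S` and the product of the standard normal densities, at
`(Φ⁻¹(u_1), …, Φ⁻¹(u_d))`. -/
def gaussianCopulaDensity {ι : Type*} [Fintype ι] [DecidableEq ι] (S : Matrix ι ι ℝ)
    (u : ι → ℝ) : ℝ :=
  gaussianVectorPDF S (quantileVector u) / ∏ i, gaussianPDFReal 0 1 (quantileVector u i)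

/-- `h` is a probability density function of the measure `ν` with respect to `μ`. -/
structure HasDensity {α : Type*} [MeasurableSpace α] (ν μ : Measure α) (h : α → ℝ) : Prop where
  measurable : Measurable h
  nonneg : ∀ x, 0 ≤ h x
  eq_withDensity : ν = μ.withDensity fun x => ENNReal.ofReal (h x)

/-- The distribution function `F₁⁺` of the integer-valued random variable `N`. -/
def freqCDF {Ω : Type*} [MeasurableSpace Ω] (P : Measure Ω) (N : Ω → ℤ) (n : ℤ) : ℝ :=
  P.real {ω | N ω ≤ n}

/-- The probability mass function `f₁⁺` of the integer-valued random variable `N`. -/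
def freqPMF {Ω : Type*} [MeasurableSpace Ω] (P : Measure Ω) (N : Ω → ℤ) (n : ℤ) : ℝ :=
  P.real {ω | N ω = n}

/-- The Gaussian copula conditional collective risk model for the positive frequency `N` and the
first `k` severities `Y`: `N` is a non-degenerate positive integer-valued random variable, `ν₂` is
a distribution on `[0,∞)` with density `f₂` and distribution function `F₂ = cdf ν₂`, and the joint
distribution function of `(N, Y_1, …, Y_k)` is `C_{Σ_{ρ₁,ρ₂}^{[k,z]}}(F₁⁺, F₂, …, F₂)`. -/
structure GaussianConditionalModel {Ω : Type*} [MeasurableSpace Ω] (P : Measure Ω)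
    (z : CorrStructure) (k : ℕ) (ρ₁ ρ₂ : ℝ) (ν₂ : Measure ℝ) (f₂ : ℝ → ℝ)
    (N : Ω → ℤ) (Y : Fin k → Ω → ℝ) : Prop where
  admissible : AdmissibleCorr z k ρ₁ ρ₂
  measurable_freq : Measurable N
  measurable_sev : ∀ i, Measurable (Y i)
  freq_pos : ∀ᵐ ω ∂P, 0 < N ω
  freq_nondegenerate : ∀ n : ℤ, ¬ (∀ᵐ ω ∂P, N ω = n)
  sev_density : HasDensity ν₂ volume f₂
  sev_nonneg : ν₂ (Set.Iio 0) = 0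
  joint_cdf : ∀ (n : ℤ) (y : Fin k → ℝ),
    P.real {ω | N ω ≤ n ∧ ∀ i, Y i ω ≤ y i} =
      gaussianCopula (jointCorr z k ρ₁ ρ₂)
        (Sum.elim (fun _ => freqCDF P N n) (fun i => cdf ν₂ (y i)))

/-- `μ_{[k,z]} = (ρ₁ 1_kᵀ) (Σ_{ρ₂}^{[k,z]})⁻¹ (Φ⁻¹(F₂(y_1)), …, Φ⁻¹(F₂(y_k)))ᵀ`. -/
def condMean (z : CorrStructure) (k : ℕ) (ρ₁ ρ₂ : ℝ) (F₂ : ℝ → ℝ) (y : Fin k → ℝ) : ℝ :=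
  (fun _ : Fin k => ρ₁) ⬝ᵥ ((severityCorr z k ρ₂)⁻¹ *ᵥ quantileVector fun i => F₂ (y i))

/-- `σ_{[k,z]} = √(1 - (ρ₁ 1_kᵀ) (Σ_{ρ₂}^{[k,z]})⁻¹ (ρ₁ 1_k))`. -/
def condSD (z : CorrStructure) (k : ℕ) (ρ₁ ρ₂ : ℝ) : ℝ :=
  Real.sqrt (1 - (fun _ : Fin k => ρ₁) ⬝ᵥ ((severityCorr z k ρ₂)⁻¹ *ᵥ fun _ => ρ₁))

/-- `f_Y(y) = c_{Σ_{ρ₂}^{[k,z]}}(F₂(y_1), …, F₂(y_k)) ∏ f₂(y_i)`. -/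
def severityDensity (z : CorrStructure) (k : ℕ) (ρ₂ : ℝ) (F₂ f₂ : ℝ → ℝ) (y : Fin k → ℝ) : ℝ :=
  gaussianCopulaDensity (severityCorr z k ρ₂) (fun i => F₂ (y i)) * ∏ i, f₂ (y i)

/-- The joint density formula
`f_Y(y) (Φ((Φ⁻¹(F₁(n)) - μ_{[k,z]}) / σ_{[k,z]}) - Φ((Φ⁻¹(F₁(n-1)) - μ_{[k,z]}) / σ_{[k,z]}))`. -/
def jointDensity (z : CorrStructure) (k : ℕ) (ρ₁ ρ₂ : ℝ) (F₁ : ℤ → ℝ) (F₂ f₂ : ℝ → ℝ)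
    (n : ℤ) (y : Fin k → ℝ) : ℝ :=
  severityDensity z k ρ₂ F₂ f₂ y *
    (stdNormalCDF ((stdNormalQuantile (F₁ n) - (condMean z k ρ₁ ρ₂ F₂ y : EReal)) /
        (condSD z k ρ₁ ρ₂ : EReal)) -
      stdNormalCDF ((stdNormalQuantile (F₁ (n - 1)) - (condMean z k ρ₁ ρ₂ F₂ y : EReal)) /
        (condSD z k ρ₁ ρ₂ : EReal)))

end

/-! Write `S` for the severity correlation matrix and `b = ρ₁ 1`. A centred Gaussian vector whose
correlation matrix has blocks `1`, `b`, `S` satisfies a regression identity: its first coordinate is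
`b ⬝ᵥ S⁻¹ x + σ ε`, where `x` is the remaining part and `ε` is an independent standard normal.
Conditioning on `x` therefore turns the Gaussian orthant probability into the integral of `Φ((a - b
⬝ᵥ S⁻¹ x) / σ)` over an orthant in `x` (`multivariateGaussian_fromBlocks_apply`).

The substitution `x i = Φ⁻¹(F₂(t i))` carries the product of the laws `ν₂` to the standard Gaussian
product, and relative to that product the law `N(0, S)` has the copula density. This moves the
integral to the scale of the severities (`setLIntegral_multivariateGaussian_le_quantile`).

Together these write `P(N ≤ n, Y ≤ y)` as an integral over `Iic y`. Lower orthants determine a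
finite measure, so the formula extends to `P(N ≤ n, Y ∈ A)` for every Borel set `A`
(`map_restrict_freq_le`). Letting `n → ∞` gives the law of `Y`, subtracting the formula at `n - 1`
gives the joint density, and dividing by `P(N = n)` gives the conditional one. -/

/-! ### Positive definiteness and the residual variance. -/

theorem severityCorr_symm (z : CorrStructure) (k : ℕ) (ρ₂ : ℝ) (i j : Fin k) :
    severityCorr z k ρ₂ i j = severityCorr z k ρ₂ j i := by
  cases z <;> simp only [severityCorr, Matrix.of_apply, eq_comm (a := i)]
  split_ifs
  · rfl
  · congr 1
    omega

theorem posDef_jointCorr_equi (k : ℕ) (ρ₁ ρ₂ : ℝ) (h : ρ₁ ^ 2 < ρ₂) (h₁ : ρ₂ < 1) :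
    (jointCorr .equi k ρ₁ ρ₂).PosDef := by
  refine PosDef.of_dotProduct_mulVec_pos ?_ fun x hx => ?_
  · ext i j
    rcases i with i | i <;> rcases j with j | j
    · simp [jointCorr]
    · simp [jointCorr]
    · simp [jointCorr]
    · simp [jointCorr, severityCorr_symm _ _ _ i]
  · have key : star x ⬝ᵥ (jointCorr .equi k ρ₁ ρ₂ *ᵥ x) =
        (x (.inl ()) + ρ₁ * ∑ i, x (.inr i)) ^ 2 + (ρ₂ - ρ₁ ^ 2) * (∑ i, x (.inr i)) ^ 2 +
          (1 - ρ₂) * ∑ i, x (.inr i) ^ 2 := by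
      have hs : ∀ i, ∑ j, severityCorr .equi k ρ₂ i j * x (.inr j) =
          ρ₂ * ∑ j, x (.inr j) + (1 - ρ₂) * x (.inr i) := by
        intro i
        have : ∀ j, severityCorr .equi k ρ₂ i j * x (.inr j) =
            ρ₂ * x (.inr j) + if i = j then (1 - ρ₂) * x (.inr j) else 0 := by
          intro j
          simp only [severityCorr, Matrix.of_apply]
          split_ifs <;> ring
        simp only [this, Finset.sum_add_distrib, ← Finset.mul_sum]
        simp
      simp only [dotProduct, mulVec, Fintype.sum_sum_type, jointCorr, fromBlocks_apply₁₁,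
        fromBlocks_apply₁₂, fromBlocks_apply₂₁, fromBlocks_apply₂₂, Finset.univ_unique,
        Finset.sum_singleton, hs, Matrix.of_apply, Pi.star_apply, star_trivial,
        ← Finset.mul_sum, PUnit.default_eq_unit]
      simp only [mul_add, Finset.sum_add_distrib, ← Finset.sum_mul, pow_two]
      have : ∑ i, x (.inr i) * ((1 - ρ₂) * x (.inr i)) =
          (1 - ρ₂) * ∑ i, x (.inr i) * x (.inr i) := by
        rw [Finset.mul_sum]
        exact Finset.sum_congr rfl fun i _ => by ring
      rw [this]
      ring
    rw [key]
    by_cases hr : ∃ i, x (.inr i) ≠ 0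
    · obtain ⟨i, hi⟩ := hr
      have h3 : 0 < ∑ i, x (.inr i) ^ 2 :=
        Finset.sum_pos' (fun _ _ => sq_nonneg _) ⟨i, Finset.mem_univ _, by positivity⟩
      have h4 := mul_pos (sub_pos.2 h₁) h3
      have h5 := mul_nonneg (sub_pos.2 h).le (sq_nonneg (∑ i, x (.inr i)))
      positivity
    · push Not at hr
      have h0 : x (.inl ()) ≠ 0 := by
        intro h0
        apply hx
        ext i
        rcases i with i | i
        · exact h0
        · exact hr i
      simp only [hr, Finset.sum_const_zero]
      simp
      positivity

theorem AdmissibleCorr.posDef_jointCorr {z : CorrStructure} {k : ℕ} {ρ₁ ρ₂ : ℝ}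
    (h : AdmissibleCorr z k ρ₁ ρ₂) : (jointCorr z k ρ₁ ρ₂).PosDef := by
  obtain ⟨_, h2, h3⟩ := h
  cases z
  · exact posDef_jointCorr_equi k ρ₁ ρ₂ h3 h2.2
  · exact h3

theorem AdmissibleCorr.posDef_severityCorr {z : CorrStructure} {k : ℕ} {ρ₁ ρ₂ : ℝ}
    (h : AdmissibleCorr z k ρ₁ ρ₂) : (severityCorr z k ρ₂).PosDef :=
  h.posDef_jointCorr.submatrix (e := Sum.inr) Sum.inr_injective

/-- This is a Schur complement: the joint quadratic form takes exactly this value at the nonzero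
vector `(1, -S⁻¹ b)`. -/
theorem AdmissibleCorr.condVar_pos {z : CorrStructure} {k : ℕ} {ρ₁ ρ₂ : ℝ}
    (h : AdmissibleCorr z k ρ₁ ρ₂) :
    0 < 1 - (fun _ : Fin k => ρ₁) ⬝ᵥ ((severityCorr z k ρ₂)⁻¹ *ᵥ fun _ => ρ₁) := by
  have hS := h.posDef_severityCorr
  set S := severityCorr z k ρ₂ with hSdef
  set b : Fin k → ℝ := fun _ => ρ₁ with hb
  let x : Unit ⊕ Fin k → ℝ := Sum.elim (fun _ => 1) (-(S⁻¹ *ᵥ b))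
  have hx : x ≠ 0 := fun h0 => by simpa [x] using congrFun h0 (.inl ())
  have := h.posDef_jointCorr.dotProduct_mulVec_pos hx
  have hSS : S *ᵥ (S⁻¹ *ᵥ b) = b := by
    rw [mulVec_mulVec, mul_nonsing_inv _ ((isUnit_iff_isUnit_det _).1 hS.isUnit), one_mulVec]
  refine this.trans_eq ?_
  have hc : (Matrix.of fun (_ : Unit) (_ : Fin k) => ρ₁) *ᵥ (S⁻¹ *ᵥ b) =
      fun _ => b ⬝ᵥ (S⁻¹ *ᵥ b) := by
    ext; simp [mulVec, dotProduct, hb]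
  have hc' : (Matrix.of fun (_ : Fin k) (_ : Unit) => ρ₁) *ᵥ (fun _ => 1) = b := by
    ext; simp [mulVec, dotProduct, hb]
  simp only [jointCorr, x, fromBlocks_mulVec, Sum.elim_comp_inl, Sum.elim_comp_inr, star_trivial,
    ← hSdef, mulVec_neg, hSS, hc, hc', sumElim_dotProduct_sumElim]
  simp [dotProduct, mulVec]
  ring

theorem AdmissibleCorr.condSD_pos {z : CorrStructure} {k : ℕ} {ρ₁ ρ₂ : ℝ}
    (h : AdmissibleCorr z k ρ₁ ρ₂) : 0 < condSD z k ρ₁ ρ₂ :=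
  Real.sqrt_pos.2 h.condVar_pos

/-! ### The standard normal distribution function and its quantile on the extended reals. -/

theorem stdNormalCDF_mono : Monotone stdNormalCDF := fun _ _ h =>
  measureReal_mono fun _ ht => le_trans ht h

theorem stdNormalCDF_nonneg (x : EReal) : 0 ≤ stdNormalCDF x := measureReal_nonneg

theorem stdNormalCDF_le_one (x : EReal) : stdNormalCDF x ≤ 1 := measureReal_le_one

@[simp]
theorem stdNormalCDF_bot : stdNormalCDF ⊥ = 0 := by simp [stdNormalCDF]

@[simp]
theorem stdNormalCDF_top : stdNormalCDF ⊤ = 1 := by simp [stdNormalCDF]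

theorem stdNormalCDF_coe (x : ℝ) : stdNormalCDF (x : EReal) = cdf (gaussianReal 0 1) x := by
  rw [cdf_eq_real, stdNormalCDF]
  congr 1
  ext t
  simp

theorem cdf_sub_cdf (μ : Measure ℝ) [IsProbabilityMeasure μ] {x y : ℝ} (h : x ≤ y) :
    cdf μ y - cdf μ x = μ.real (Set.Ioc x y) := by
  have : Set.Ioc x y = Set.Iic y \ Set.Iic x := by ext; simp [and_comm]
  rw [cdf_eq_real, cdf_eq_real, this, measureReal_sdiff (Set.Iic_subset_Iic.2 h) measurableSet_Iic]

/-- The jump of the distribution function at a point is the mass of that point, which is zero here.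
-/
theorem continuous_cdf_of_absolutelyContinuous (μ : Measure ℝ) [IsProbabilityMeasure μ]
    (h : μ ≪ volume) : Continuous (cdf μ) := by
  rw [continuous_iff_continuousAt]
  intro x
  rw [(monotone_cdf μ).continuousAt_iff_leftLim_eq_rightLim, (cdf μ).rightLim_eq]
  have h1 := (cdf μ).measure_singleton x
  rw [measure_cdf, h (by simp : volume {x} = 0)] at h1
  have h2 := ENNReal.ofReal_eq_zero.1 h1.symm
  exact le_antisymm ((monotone_cdf μ).leftLim_le le_rfl) (by linarith)

theorem gaussianReal_real_Ioc_pos {x y : ℝ} (h : x < y) :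
    0 < (gaussianReal 0 1).real (Set.Ioc x y) := by
  rw [measureReal_def, ENNReal.toReal_pos_iff]
  refine ⟨pos_iff_ne_zero.2 fun h0 => ?_, measure_lt_top _ _⟩
  have := gaussianReal_absolutelyContinuous' 0 one_ne_zero h0
  simp at this
  linarith

theorem strictMono_cdf_gaussianReal : StrictMono (cdf (gaussianReal 0 1)) := fun x y h => by
  have := gaussianReal_real_Ioc_pos h
  rw [← cdf_sub_cdf _ h.le] at this
  linarith

theorem cdf_gaussianReal_pos (x : ℝ) : 0 < cdf (gaussianReal 0 1) x :=
  (cdf_nonneg _ (x - 1)).trans_lt (strictMono_cdf_gaussianReal (by linarith))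

theorem cdf_gaussianReal_lt_one (x : ℝ) : cdf (gaussianReal 0 1) x < 1 :=
  (strictMono_cdf_gaussianReal (by linarith : x < x + 1)).trans_le (cdf_le_one _ _)

theorem exists_cdf_eq (μ : Measure ℝ) [IsProbabilityMeasure μ] (h : Continuous (cdf μ)) {u : ℝ}
    (h0 : 0 < u) (h1 : u < 1) : ∃ x, cdf μ x = u := by
  obtain ⟨a, ha⟩ := ((tendsto_cdf_atBot μ).eventually (gt_mem_nhds h0)).exists
  obtain ⟨b, hb⟩ := ((tendsto_cdf_atTop μ).eventually (lt_mem_nhds h1)).exists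
  exact mem_range_of_exists_le_of_exists_ge h ⟨a, ha.le⟩ ⟨b, hb.le⟩

theorem strictMono_stdNormalCDF : StrictMono stdNormalCDF := by
  intro x y h
  induction x <;> induction y
  all_goals simp_all [stdNormalCDF_coe, cdf_gaussianReal_pos, cdf_gaussianReal_lt_one,
    strictMono_cdf_gaussianReal.lt_iff_lt]

theorem exists_stdNormalCDF_eq {u : ℝ} (h0 : 0 ≤ u) (h1 : u ≤ 1) : ∃ x, stdNormalCDF x = u := by
  rcases h0.eq_or_lt with rfl | h0
  · exact ⟨⊥, by simp⟩
  rcases h1.eq_or_lt with rfl | h1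
  · exact ⟨⊤, by simp⟩
  obtain ⟨x, hx⟩ := exists_cdf_eq _ (continuous_cdf_of_absolutelyContinuous _
    (gaussianReal_absolutelyContinuous 0 one_ne_zero)) h0 h1
  exact ⟨x, by rw [stdNormalCDF_coe, hx]⟩

-- On `EReal`, `Φ` is strictly increasing with range `[0,1]`, so the infimum defining the quantile
-- runs over the ray `Ici x`.
@[simp]
theorem stdNormalQuantile_stdNormalCDF (x : EReal) : stdNormalQuantile (stdNormalCDF x) = x := by
  simp only [stdNormalQuantile, strictMono_stdNormalCDF.le_iff_le]
  exact isGLB_Ici.sInf_eq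

theorem stdNormalQuantile_mono : Monotone stdNormalQuantile := fun _ _ h =>
  sInf_le_sInf fun _ hx => h.trans hx

theorem stdNormalQuantile_le_iff {u v : ℝ} (hu : u ∈ Set.Icc 0 1) (hv : v ∈ Set.Icc 0 1) :
    stdNormalQuantile u ≤ stdNormalQuantile v ↔ u ≤ v := by
  obtain ⟨x, rfl⟩ := exists_stdNormalCDF_eq hu.1 hu.2
  obtain ⟨y, rfl⟩ := exists_stdNormalCDF_eq hv.1 hv.2
  simp [strictMono_stdNormalCDF.le_iff_le]

theorem coe_toReal_stdNormalQuantile {u : ℝ} (h0 : 0 < u) (h1 : u < 1) :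
    ((stdNormalQuantile u).toReal : EReal) = stdNormalQuantile u := by
  obtain ⟨x, rfl⟩ := exists_stdNormalCDF_eq h0.le h1.le
  rw [stdNormalQuantile_stdNormalCDF]
  apply EReal.coe_toReal
  · rintro rfl
    simp at h1
  · rintro rfl
    simp at h0

/-- Since `m` and `s` are finite, no `∞ - ∞` arises. The cases `a = ±∞` are needed because the
frequency distribution function may equal `0` or `1`. -/
theorem coe_le_stdNormalStandardize_iff (a : EReal) (m : ℝ) {s : ℝ} (hs : 0 < s) (t : ℝ) :
    (t : EReal) ≤ (a - (m : EReal)) / (s : EReal) ↔ ((m + s * t : ℝ) : EReal) ≤ a := by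
  rw [EReal.le_div_iff_mul_le (by exact_mod_cast hs) (EReal.coe_ne_top s)]
  induction a with
  | bot =>
    rw [EReal.bot_sub, ← EReal.coe_mul]
    simp only [le_bot_iff, EReal.coe_ne_bot]
  | top => simp
  | coe a =>
    norm_cast
    constructor <;> intro <;> linarith

theorem sub_coe_div_coe_mono (m : ℝ) {s : ℝ} (hs : 0 < s) :
    Monotone fun a : EReal => (a - (m : EReal)) / (s : EReal) := fun _ _ h =>
  EReal.div_le_div_right_of_nonneg (by exact_mod_cast hs.le) (EReal.sub_le_sub h le_rfl)

theorem measurable_stdNormalCDF : Measurable stdNormalCDF := stdNormalCDF_mono.measurable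

theorem measurable_stdNormalQuantile : Measurable stdNormalQuantile :=
  stdNormalQuantile_mono.measurable

theorem measurable_quantileVector {ι : Type*} [Fintype ι] :
    Measurable (quantileVector : (ι → ℝ) → ι → ℝ) :=
  measurable_pi_lambda _ fun i =>
    measurable_ereal_toReal.comp (measurable_stdNormalQuantile.comp (measurable_pi_apply i))

theorem measurable_stdNormalCDF_standardize (a : EReal) {s : ℝ} :
    Measurable fun m : ℝ => stdNormalCDF ((a - (m : EReal)) / (s : EReal)) := by
  refine measurable_stdNormalCDF.comp ?_
  induction a with
  | bot => simp only [EReal.bot_sub]; exact measurable_const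
  | top => simp only [EReal.top_sub_coe]; exact measurable_const
  | coe a =>
    have : (fun m : ℝ => ((a : EReal) - (m : EReal)) / (s : EReal)) =
        fun m : ℝ => (((a - m) / s : ℝ) : EReal) := by
      ext m; rfl
    rw [this]
    exact measurable_coe_real_ereal.comp (by fun_prop)

/-! ### The probability integral transform. -/

/-- A continuous distribution function need not be injective, but its flat stretches carry no mass.
The one to the right of `y` lies in some `(y, s]` with equal values at both ends, or else is
unbounded and then `F(y) = 1`. -/
theorem measure_setOf_lt_and_cdf_le (μ : Measure ℝ) [IsProbabilityMeasure μ]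
    (h : Continuous (cdf μ)) (y : ℝ) : μ {t | y < t ∧ cdf μ t ≤ cdf μ y} = 0 := by
  by_cases hb : BddAbove {t | cdf μ t ≤ cdf μ y}
  · have hne : {t | cdf μ t ≤ cdf μ y}.Nonempty := ⟨y, le_refl (cdf μ y)⟩
    have hmem := (isClosed_le h continuous_const).csSup_mem hne hb
    set s := sSup {t | cdf μ t ≤ cdf μ y}
    have hys : y ≤ s := le_csSup hb (le_refl (cdf μ y))
    refine measure_mono_null (t := Set.Ioc y s) (fun t ht => ⟨ht.1, le_csSup hb ht.2⟩) ?_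
    rw [← measureReal_eq_zero_iff, ← cdf_sub_cdf μ hys]
    have := monotone_cdf μ hys
    have : cdf μ s ≤ cdf μ y := hmem
    linarith
  · have h1 : ∀ t, cdf μ t ≤ cdf μ y := fun t => by
      by_contra hc
      refine hb ⟨t, fun x hx => ?_⟩
      by_contra hx'
      exact hc ((monotone_cdf μ (not_le.1 hx').le).trans hx)
    have h2 : (1 : ℝ) ≤ cdf μ y := le_of_tendsto' (tendsto_cdf_atTop μ) h1
    refine measure_mono_null (t := (Set.Iic y)ᶜ) (fun t ht => by simpa using ht.1) ?_
    rw [prob_compl_eq_zero_iff measurableSet_Iic, ← ofReal_cdf,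
      le_antisymm (cdf_le_one μ y) h2, ENNReal.ofReal_one]

theorem ae_cdf_le_cdf_iff (μ : Measure ℝ) [IsProbabilityMeasure μ] (h : Continuous (cdf μ))
    (y : ℝ) : ∀ᵐ t ∂μ, (cdf μ t ≤ cdf μ y ↔ t ≤ y) := by
  have := measure_setOf_lt_and_cdf_le μ h y
  rw [measure_eq_zero_iff_ae_notMem] at this
  filter_upwards [this] with t ht
  refine ⟨fun h1 => ?_, fun h1 => monotone_cdf μ h1⟩
  by_contra h2
  exact ht ⟨not_le.1 h2, h1⟩

theorem measure_setOf_cdf_le (μ : Measure ℝ) [IsProbabilityMeasure μ] (h : Continuous (cdf μ))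
    {u : ℝ} (h0 : 0 < u) (h1 : u < 1) : μ {t | cdf μ t ≤ u} = ENNReal.ofReal u := by
  obtain ⟨y, rfl⟩ := exists_cdf_eq μ h h0 h1
  rw [ofReal_cdf]
  exact measure_congr ((ae_cdf_le_cdf_iff μ h y).mono fun t ht => propext ht)

theorem ae_cdf_pos (μ : Measure ℝ) [IsProbabilityMeasure μ] (h : Continuous (cdf μ)) :
    ∀ᵐ t ∂μ, 0 < cdf μ t := by
  by_cases hy : ∃ y, cdf μ y = 0
  · obtain ⟨y, hy⟩ := hy
    have h0 : μ (Set.Iic y) = 0 := by rw [← ofReal_cdf, hy, ENNReal.ofReal_zero]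
    rw [measure_eq_zero_iff_ae_notMem] at h0
    filter_upwards [h0, ae_cdf_le_cdf_iff μ h y] with t h1 h2
    rw [← hy]
    by_contra h3
    exact h1 (h2.1 (not_lt.1 h3))
  · push Not at hy
    exact .of_forall fun t => lt_of_le_of_ne (cdf_nonneg μ t) (hy t).symm

theorem ae_cdf_lt_one (μ : Measure ℝ) [IsProbabilityMeasure μ] (h : Continuous (cdf μ)) :
    ∀ᵐ t ∂μ, cdf μ t < 1 := by
  rw [ae_iff]
  simp only [not_lt]
  by_contra h0
  obtain ⟨v, hv0, hv⟩ := ENNReal.lt_iff_exists_real_btwn.1 (pos_iff_ne_zero.2 h0)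
  have hv' : 0 < v := by simpa using hv.1
  have hv1 : v < 1 := by
    have := hv.2.trans_le prob_le_one
    rwa [ENNReal.ofReal_lt_one] at this
  -- If `{F ≥ 1}` had mass above `v`, it would still lie in `(y, ∞)`, which has mass exactly `v`.
  obtain ⟨y, hy⟩ := exists_cdf_eq μ h (sub_pos.2 hv1) (by linarith : 1 - v < 1)
  have hsub : {t | 1 ≤ cdf μ t} ⊆ (Set.Iic y)ᶜ := fun t ht hty => by
    have h1 := monotone_cdf μ (Set.mem_Iic.1 hty)
    have h2 : 1 ≤ cdf μ t := ht
    linarith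
  have := hv.2.trans_le (measure_mono hsub)
  rw [prob_compl_eq_one_sub measurableSet_Iic, ← ofReal_cdf, hy, ← ENNReal.ofReal_one,
    ← ENNReal.ofReal_sub _ (sub_pos.2 hv1).le] at this
  simp at this

theorem ae_coe_toReal_stdNormalQuantile_cdf (μ : Measure ℝ) [IsProbabilityMeasure μ]
    (h : Continuous (cdf μ)) : ∀ᵐ t ∂μ,
      ((stdNormalQuantile (cdf μ t)).toReal : EReal) = stdNormalQuantile (cdf μ t) := by
  filter_upwards [ae_cdf_pos μ h, ae_cdf_lt_one μ h] with t h0 h1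
  exact coe_toReal_stdNormalQuantile h0 h1

theorem measurable_toReal_stdNormalQuantile_cdf (μ : Measure ℝ) :
    Measurable fun t => (stdNormalQuantile (cdf μ t)).toReal :=
  measurable_ereal_toReal.comp (measurable_stdNormalQuantile.comp (monotone_cdf μ).measurable)

/-- `F(T)` is uniform when `F` is continuous. The value `0` that `toReal` gives to `±∞` occurs only
on a null set. -/
theorem map_stdNormalQuantile_cdf (μ : Measure ℝ) [IsProbabilityMeasure μ]
    (h : Continuous (cdf μ)) :
    μ.map (fun t => (stdNormalQuantile (cdf μ t)).toReal) = gaussianReal 0 1 := by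
  have hm := measurable_toReal_stdNormalQuantile_cdf μ
  have := Measure.isProbabilityMeasure_map (μ := μ) hm.aemeasurable
  refine Measure.ext_of_Iic _ _ fun x => ?_
  rw [Measure.map_apply hm measurableSet_Iic, ← ofReal_cdf (gaussianReal 0 1),
    ← measure_setOf_cdf_le μ h (cdf_gaussianReal_pos x) (cdf_gaussianReal_lt_one x)]
  refine measure_congr ((ae_coe_toReal_stdNormalQuantile_cdf μ h).mono fun t ht => propext ?_)
  change (stdNormalQuantile (cdf μ t)).toReal ≤ x ↔ cdf μ t ≤ _
  rw [← EReal.coe_le_coe_iff, ht, ← stdNormalQuantile_stdNormalCDF (x : EReal),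
    stdNormalQuantile_le_iff ⟨cdf_nonneg _ _, cdf_le_one _ _⟩
      ⟨stdNormalCDF_nonneg _, stdNormalCDF_le_one _⟩, stdNormalCDF_coe]

/-! ### Product densities, and measures determined by lower orthants. -/

theorem lintegral_prod_eval_pi {n : ℕ} (μ : Fin n → Measure ℝ)
    [∀ i, SigmaFinite (μ i)] {f : Fin n → ℝ → ENNReal} (hf : ∀ i, Measurable (f i)) :
    ∫⁻ x, ∏ i, f i (x i) ∂Measure.pi μ = ∏ i, ∫⁻ x, f i x ∂μ i := by
  induction n with
  | zero => simp
  | succ n ih =>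
    calc
      _ = ∫⁻ x : ℝ × (Fin n → ℝ), f 0 x.1 * ∏ i : Fin n, f i.succ (x.2 i)
            ∂((μ 0).prod (Measure.pi fun i => μ i.succ)) := by
        rw [← ((measurePreserving_piFinSuccAbove μ 0).symm).lintegral_comp_emb
          (MeasurableEquiv.measurableEmbedding _)]
        simp_rw [MeasurableEquiv.piFinSuccAbove_symm_apply, Fin.insertNthEquiv,
          Fin.prod_univ_succ, Fin.insertNth_zero, Equiv.coe_fn_mk, Fin.cons_succ,
          Fin.zero_succAbove, cast_eq, Fin.cons_zero]
      _ = (∫⁻ x, f 0 x ∂μ 0) * ∏ i : Fin n, ∫⁻ x, f i.succ x ∂μ i.succ := by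
        rw [← ih (fun i => μ i.succ) fun i => hf i.succ]
        exact lintegral_prod_mul (g := fun y : Fin n → ℝ => ∏ i : Fin n, f i.succ (y i))
          (hf 0).aemeasurable (Finset.measurable_prod _ fun i _ =>
            (hf i.succ).comp (measurable_pi_apply i)).aemeasurable
      _ = ∏ i, ∫⁻ x, f i x ∂μ i := by rw [Fin.prod_univ_succ]

theorem pi_withDensity {n : ℕ} (μ : Fin n → Measure ℝ)
    [∀ i, SigmaFinite (μ i)] {f : Fin n → ℝ → ENNReal} (hf : ∀ i, Measurable (f i))
    [∀ i, SigmaFinite ((μ i).withDensity (f i))] :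
    Measure.pi (fun i => (μ i).withDensity (f i)) =
      (Measure.pi μ).withDensity fun x => ∏ i, f i (x i) := by
  refine Measure.pi_eq fun s hs => ?_
  rw [withDensity_apply _ (MeasurableSet.univ_pi hs), Measure.restrict_pi_pi,
    lintegral_prod_eval_pi _ hf]
  exact Finset.prod_congr rfl fun i _ => (withDensity_apply _ (hs i)).symm

theorem measure_pi_ext_of_Iic {ι : Type*} [Finite ι] (μ ν : Measure (ι → ℝ)) [IsFiniteMeasure μ]
    (h : ∀ y, μ (Set.Iic y) = ν (Set.Iic y)) : μ = ν := by
  have hgen : (MeasurableSpace.pi : MeasurableSpace (ι → ℝ)) =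
      MeasurableSpace.generateFrom (Set.pi Set.univ '' Set.pi Set.univ fun _ => Set.range Set.Iic) :=
    by
    refine (generateFrom_eq_pi (fun _ => ?_) fun _ => ?_).symm
    · rw [← borel_eq_generateFrom_Iic, BorelSpace.measurable_eq (α := ℝ)]
    · exact ⟨fun n : ℕ => Set.Iic (n : ℝ), fun n => ⟨n, rfl⟩, by
        ext x; simpa using exists_nat_ge x⟩
  have hpi : IsPiSystem (Set.pi Set.univ '' Set.pi Set.univ fun _ : ι => Set.range (Set.Iic (α := ℝ))) :=
    IsPiSystem.pi fun _ => by
      rintro _ ⟨a, rfl⟩ _ ⟨b, rfl⟩ _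
      exact ⟨a ⊓ b, by simp⟩
  refine Measure.ext_of_generateFrom_of_iUnion _ (fun n : ℕ => Set.Iic fun _ => (n : ℝ)) hgen hpi
    ?_ (fun n => ⟨fun _ => Set.Iic (n : ℝ), fun _ _ => ⟨n, rfl⟩, Set.pi_univ_Iic _⟩)
    (fun _ => measure_ne_top _ _) ?_
  · ext x
    simp only [Set.mem_iUnion, Set.mem_Iic, Set.mem_univ, iff_true]
    cases nonempty_fintype ι
    obtain ⟨n, hn⟩ := exists_nat_ge (∑ i, |x i|)
    exact ⟨n, fun i => (le_abs_self _).trans ((Finset.single_le_sum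
      (f := fun i => |x i|) (fun _ _ => abs_nonneg _) (Finset.mem_univ i)).trans hn)⟩
  · rintro _ ⟨s, hs, rfl⟩
    choose y hy using fun i => hs i (Set.mem_univ i)
    obtain rfl : (fun i => Set.Iic (y i)) = s := funext hy
    rw [Set.pi_univ_Iic]
    exact h y

/-! ### The density of a nondegenerate Gaussian vector. -/

section
open scoped MatrixOrder

/-- With a symmetric square root `R`, the quadratic form is the squared norm of `R⁻¹ y` and `√(det
S) = |det R|`. The right side is what the linear change of variables by `R` produces. -/
theorem gaussianVectorPDF_eq_of_sq {n : ℕ} {S R : Matrix (Fin n) (Fin n) ℝ}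
    (hR : Rᵀ = R) (hRS : R * R = S) (y : Fin n → ℝ) :
    gaussianVectorPDF S y = |R.det⁻¹| * ∏ i, gaussianPDFReal 0 1 ((R⁻¹ *ᵥ y) i) := by
  have hq : y ⬝ᵥ (S⁻¹ *ᵥ y) = ∑ i, (R⁻¹ *ᵥ y) i ^ 2 := by
    rw [← hRS, Matrix.mul_inv_rev, ← mulVec_mulVec, dotProduct_mulVec, ← mulVec_transpose,
      transpose_nonsing_inv, hR]
    simp [dotProduct, pow_two]
  simp only [gaussianVectorPDF, gaussianPDFReal, Finset.prod_mul_distrib, ← Real.exp_sum, hq,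
    Finset.prod_const, Finset.card_univ, Fintype.card_fin, NNReal.coe_one, mul_one, sub_zero]
  rw [← hRS, det_mul, Real.sqrt_mul (by positivity), Real.sqrt_mul_self_eq_abs, mul_inv, abs_inv,
    ← Finset.sum_div, Finset.sum_neg_distrib, inv_pow]
  have : √((2 * Real.pi) ^ n) = √(2 * Real.pi) ^ n := by
    rw [Real.sqrt_eq_iff_mul_self_eq (by positivity) (by positivity), ← mul_pow,
      Real.mul_self_sqrt (by positivity)]
  rw [this]
  ring

theorem measurable_gaussianVectorPDF {ι : Type*} [Fintype ι] [DecidableEq ι] (S : Matrix ι ι ℝ) :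
    Measurable (gaussianVectorPDF S) := by
  unfold gaussianVectorPDF
  have : Continuous fun x : ι → ℝ => x ⬝ᵥ (S⁻¹ *ᵥ x) := by fun_prop
  fun_prop

theorem gaussianVectorPDF_nonneg {ι : Type*} [Fintype ι] [DecidableEq ι] (S : Matrix ι ι ℝ)
    (x : ι → ℝ) : 0 ≤ gaussianVectorPDF S x := by
  unfold gaussianVectorPDF
  positivity

theorem pi_gaussianReal_eq_withDensity (n : ℕ) :
    Measure.pi (fun _ : Fin n => gaussianReal 0 1) =
      volume.withDensity fun x => ENNReal.ofReal (∏ i, gaussianPDFReal 0 1 (x i)) := by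
  have h : gaussianReal 0 1 = volume.withDensity (gaussianPDF 0 1) :=
    gaussianReal_of_var_ne_zero 0 one_ne_zero
  have : SigmaFinite ((volume : Measure ℝ).withDensity (gaussianPDF 0 1)) := by
    rw [← h]; infer_instance
  rw [h, pi_withDensity _ fun _ => measurable_gaussianPDF 0 1, volume_pi]
  congr 1
  ext x
  rw [ENNReal.ofReal_prod_of_nonneg fun i _ => gaussianPDFReal_nonneg _ _ _]
  rfl

theorem multivariateGaussian_eq_withDensity {n : ℕ} {S : Matrix (Fin n) (Fin n) ℝ}
    (hS : S.PosDef) :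
    multivariateGaussian (0 : EuclideanSpace ℝ (Fin n)) S =
      (volume.withDensity fun x => ENNReal.ofReal (gaussianVectorPDF S x)).map
        (WithLp.toLp 2) := by
  -- `multivariateGaussian` is by definition an affine image of the standard Gaussian under this
  -- square root.
  set R := CFC.sqrt S with hRdef
  have hRS : R * R = S := CFC.sqrt_mul_sqrt_self _ hS.posSemidef.nonneg
  have hR : Rᵀ = R := by
    have := (CFC.sqrt_nonneg S).isSelfAdjoint
    rw [isSelfAdjoint_iff, star_eq_conjTranspose] at this
    simpa using this
  have hdet : R.det ≠ 0 := fun h0 => by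
    have := hS.det_pos
    rw [← hRS, det_mul, h0] at this
    simp at this
  have hinv : ∀ x : Fin n → ℝ, R⁻¹ *ᵥ (R *ᵥ x) = x := fun x => by
    rw [mulVec_mulVec, nonsing_inv_mul _ (isUnit_iff_ne_zero.2 hdet), one_mulVec]
  have hm : Measurable (toLin' R : (Fin n → ℝ) → Fin n → ℝ) :=
    (LinearMap.continuous_of_finiteDimensional _).measurable
  have hgd : Measurable fun y : Fin n → ℝ =>
      ENNReal.ofReal (∏ i, gaussianPDFReal 0 1 ((R⁻¹ *ᵥ y) i)) := by
    refine ENNReal.measurable_ofReal.comp (Finset.measurable_prod _ fun i _ =>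
      (measurable_gaussianPDFReal 0 1).comp ?_)
    have : Continuous fun y : Fin n → ℝ => R⁻¹ *ᵥ y := by fun_prop
    exact (measurable_pi_apply i).comp this.measurable
  have hlin : (Measure.pi fun _ : Fin n => gaussianReal 0 1).map (toLin' R) =
      volume.withDensity fun x => ENNReal.ofReal (gaussianVectorPDF S x) := by
    ext s hs
    rw [Measure.map_apply hm hs, pi_gaussianReal_eq_withDensity, withDensity_apply _ (hm hs),
      withDensity_apply _ hs]
    have h1 : ∫⁻ y in s, ENNReal.ofReal (∏ i, gaussianPDFReal 0 1 ((R⁻¹ *ᵥ y) i))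
        ∂(volume.map (toLin' R)) = ∫⁻ x in toLin' R ⁻¹' s,
          ENNReal.ofReal (∏ i, gaussianPDFReal 0 1 (x i)) := by
      rw [setLIntegral_map hs hgd hm]
      simp only [toLin'_apply, hinv]
    rw [← h1, Real.map_matrix_volume_pi_eq_smul_volume_pi hdet, Measure.restrict_smul,
      lintegral_smul_measure, smul_eq_mul, ← lintegral_const_mul _ hgd]
    refine lintegral_congr fun y => ?_
    rw [gaussianVectorPDF_eq_of_sq hR hRS, ENNReal.ofReal_mul (abs_nonneg _)]
  rw [← hlin, multivariateGaussian, ← map_pi_eq_stdGaussian, Measure.map_map (by fun_prop)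
    (by fun_prop), Measure.map_map (by fun_prop) hm]
  congr 1
  ext x i
  simp [← hRdef]

end

theorem lintegral_multivariateGaussian {n : ℕ} {S : Matrix (Fin n) (Fin n) ℝ} (hS : S.PosDef)
    {W : (Fin n → ℝ) → ENNReal} (hW : Measurable W) :
    ∫⁻ x, W (WithLp.ofLp x) ∂multivariateGaussian (0 : EuclideanSpace ℝ (Fin n)) S =
      ∫⁻ x, ENNReal.ofReal (gaussianVectorPDF S x / ∏ i, gaussianPDFReal 0 1 (x i)) * W x
        ∂Measure.pi fun _ => gaussianReal 0 1 := by
  have hp : Measurable fun x : Fin n → ℝ => ∏ i, gaussianPDFReal 0 1 (x i) :=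
    Finset.measurable_prod _ fun i _ =>
      (measurable_gaussianPDFReal 0 1).comp (measurable_pi_apply i)
  have hg := measurable_gaussianVectorPDF S
  rw [multivariateGaussian_eq_withDensity hS, pi_gaussianReal_eq_withDensity,
    lintegral_map (by fun_prop) (by fun_prop),
    lintegral_withDensity_eq_lintegral_mul _ (by fun_prop) hW,
    lintegral_withDensity_eq_lintegral_mul _ (by fun_prop) (by fun_prop)]
  refine lintegral_congr fun x => ?_
  have hpos : 0 < ∏ i, gaussianPDFReal 0 1 (x i) :=
    Finset.prod_pos fun i _ => gaussianPDFReal_pos 0 1 (x i) one_ne_zero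
  simp only [Pi.mul_apply]
  rw [← mul_assoc, ← ENNReal.ofReal_mul hpos.le, mul_div_cancel₀ _ hpos.ne']

/-! ### The copula density and the passage to the severity scale. -/

theorem gaussianCopulaDensity_nonneg {ι : Type*} [Fintype ι] [DecidableEq ι] (S : Matrix ι ι ℝ)
    (u : ι → ℝ) : 0 ≤ gaussianCopulaDensity S u :=
  div_nonneg (gaussianVectorPDF_nonneg _ _)
    (Finset.prod_nonneg fun _ _ => gaussianPDFReal_nonneg _ _ _)

theorem measurable_gaussianCopulaDensity {ι : Type*} [Fintype ι] [DecidableEq ι]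
    (S : Matrix ι ι ℝ) : Measurable (gaussianCopulaDensity S) :=
  ((measurable_gaussianVectorPDF S).comp measurable_quantileVector).div
    (Finset.measurable_prod _ fun i _ => (measurable_gaussianPDFReal 0 1).comp
      ((measurable_pi_apply i).comp measurable_quantileVector))

/-- Change of variables from Gaussian coordinates to the scale of a distribution with a density. -/
theorem setLIntegral_multivariateGaussian_le_quantile {n : ℕ} {S : Matrix (Fin n) (Fin n) ℝ}
    (hS : S.PosDef) (ν : Measure ℝ) [IsProbabilityMeasure ν] {f : ℝ → ℝ}
    (hf : HasDensity ν volume f) {W : (Fin n → ℝ) → ENNReal} (hW : Measurable W)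
    (y : Fin n → ℝ) :
    ∫⁻ x in {x | ∀ i, ((x i : ℝ) : EReal) ≤ stdNormalQuantile (cdf ν (y i))}, W (WithLp.ofLp x)
        ∂multivariateGaussian (0 : EuclideanSpace ℝ (Fin n)) S =
      ∫⁻ t in Set.Iic y, ENNReal.ofReal
        (gaussianCopulaDensity S (fun i => cdf ν (t i)) * ∏ i, f (t i)) *
          W (quantileVector fun i => cdf ν (t i)) := by
  have hac : ν ≪ volume := by
    rw [hf.eq_withDensity]; exact withDensity_absolutelyContinuous _ _
  have hc := continuous_cdf_of_absolutelyContinuous ν hac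
  have hT := measurable_toReal_stdNormalQuantile_cdf ν
  let Q : Set (Fin n → ℝ) := {x | ∀ i, ((x i : ℝ) : EReal) ≤ stdNormalQuantile (cdf ν (y i))}
  have hQ : MeasurableSet Q := by
    have : Q = ⋂ i, {x | ((x i : ℝ) : EReal) ≤ stdNormalQuantile (cdf ν (y i))} := by
      ext; simp [Q]
    rw [this]
    exact MeasurableSet.iInter fun i => measurableSet_le
      (measurable_coe_real_ereal.comp (measurable_pi_apply i)) measurable_const
  have hQ' : MeasurableSet {x : EuclideanSpace ℝ (Fin n) |
      ∀ i, ((x i : ℝ) : EReal) ≤ stdNormalQuantile (cdf ν (y i))} :=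
    hQ.preimage (WithLp.measurable_ofLp 2 _)
  have hcm : Measurable fun (t : Fin n → ℝ) i => cdf ν (t i) :=
    measurable_pi_lambda _ fun i => hc.measurable.comp (measurable_pi_apply i)
  have hqm : Measurable fun t : Fin n → ℝ => quantileVector fun i => cdf ν (t i) :=
    measurable_quantileVector.comp hcm
  have hcd := (measurable_gaussianCopulaDensity S).comp hcm
  have hfm := hf.measurable
  have hpi : (Measure.pi fun _ : Fin n => gaussianReal 0 1) =
      (Measure.pi fun _ : Fin n => ν).map fun t => quantileVector fun i => cdf ν (t i) := by
    have : ∀ _ : Fin n, SigmaFinite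
        (ν.map fun t => (stdNormalQuantile (cdf ν t)).toReal) := fun _ => by
      rw [map_stdNormalQuantile_cdf ν hc]; infer_instance
    rw [← map_stdNormalQuantile_cdf ν hc]
    exact (Measure.pi_map_pi fun _ => hT.aemeasurable).symm
  have hpiν : (Measure.pi fun _ : Fin n => ν) =
      volume.withDensity fun t => ENNReal.ofReal (∏ i, f (t i)) := by
    have : SigmaFinite (volume.withDensity fun t => ENNReal.ofReal (f t)) := by
      rw [← hf.eq_withDensity]; infer_instance
    conv_lhs => rw [hf.eq_withDensity]
    rw [pi_withDensity _ fun _ => hf.measurable.ennreal_ofReal, volume_pi]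
    congr 1
    ext t
    rw [ENNReal.ofReal_prod_of_nonneg fun i _ => hf.nonneg _]
  -- The two orthants correspond only almost everywhere: flat stretches of the distribution function
  -- and infinite quantiles must be discarded.
  have hae : ∀ᵐ t ∂(Measure.pi fun _ : Fin n => ν),
      ((quantileVector fun i => cdf ν (t i)) ∈ Q ↔ t ∈ Set.Iic y) := by
    have h1 : ∀ᵐ t ∂(Measure.pi fun _ : Fin n => ν), ∀ i,
        (((stdNormalQuantile (cdf ν (t i))).toReal : EReal) = stdNormalQuantile (cdf ν (t i)) ∧
          (cdf ν (t i) ≤ cdf ν (y i) ↔ t i ≤ y i)) := by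
      rw [ae_all_iff]
      intro i
      exact (Measure.quasiMeasurePreserving_eval (fun _ => ν) i).ae
        ((ae_coe_toReal_stdNormalQuantile_cdf ν hc).and (ae_cdf_le_cdf_iff ν hc (y i)))
    filter_upwards [h1] with t ht
    refine forall_congr' fun i => ?_
    rw [← (ht i).2]
    change ((stdNormalQuantile (cdf ν (t i))).toReal : EReal) ≤ _ ↔ _
    rw [(ht i).1, stdNormalQuantile_le_iff ⟨cdf_nonneg _ _, cdf_le_one _ _⟩
      ⟨cdf_nonneg _ _, cdf_le_one _ _⟩]
  rw [← lintegral_indicator hQ']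
  calc
    _ = ∫⁻ x, Q.indicator W (WithLp.ofLp x)
          ∂multivariateGaussian (0 : EuclideanSpace ℝ (Fin n)) S := rfl
    _ = ∫⁻ t, ENNReal.ofReal (gaussianCopulaDensity S fun i => cdf ν (t i)) *
          Q.indicator W (quantileVector fun i => cdf ν (t i)) ∂(Measure.pi fun _ => ν) := by
      rw [lintegral_multivariateGaussian hS (hW.indicator hQ), hpi, lintegral_map _ hqm]
      · rfl
      · have hp : Measurable fun x : Fin n → ℝ => ∏ i, gaussianPDFReal 0 1 (x i) :=
          Finset.measurable_prod _ fun i _ =>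
            (measurable_gaussianPDFReal 0 1).comp (measurable_pi_apply i)
        exact ((measurable_gaussianVectorPDF S).div hp).ennreal_ofReal.mul (hW.indicator hQ)
    _ = ∫⁻ t, (Set.Iic y).indicator (fun t =>
          ENNReal.ofReal (gaussianCopulaDensity S fun i => cdf ν (t i)) *
          W (quantileVector fun i => cdf ν (t i))) t ∂(Measure.pi fun _ => ν) := by
      refine lintegral_congr_ae (hae.mono fun t ht => ?_)
      by_cases hty : t ∈ Set.Iic y
      · simp only [Set.indicator_of_mem hty, Set.indicator_of_mem (ht.2 hty)]
      · simp only [Set.indicator_of_notMem hty, Set.indicator_of_notMem fun h => hty (ht.1 h),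
          mul_zero]
    _ = _ := by
      rw [lintegral_indicator measurableSet_Iic, hpiν, restrict_withDensity measurableSet_Iic,
        lintegral_withDensity_eq_lintegral_mul]
      · refine lintegral_congr fun t => ?_
        simp only [Pi.mul_apply]
        rw [← mul_assoc, ← ENNReal.ofReal_mul (Finset.prod_nonneg fun i _ => hf.nonneg _),
          mul_comm (∏ i, f (t i))]
      · exact (Finset.measurable_prod _ fun i _ =>
          hfm.comp (measurable_pi_apply i)).ennreal_ofReal
      · exact hcd.ennreal_ofReal.mul (hW.comp hqm)

/-! ### Regression of the first Gaussian coordinate on the others. -/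

theorem continuous_regression {n : ℕ} (S : Matrix (Fin n) (Fin n) ℝ) (b : Fin n → ℝ) (s : ℝ) :
    Continuous fun p : ℝ × EuclideanSpace ℝ (Fin n) => WithLp.toLp 2
      (Sum.elim (fun _ : Unit => b ⬝ᵥ (S⁻¹ *ᵥ WithLp.ofLp p.2) + s * p.1) (WithLp.ofLp p.2)) := by
  refine (PiLp.continuous_toLp 2 _).comp (continuous_pi fun i => ?_)
  rcases i with i | i
  · simp only [Sum.elim_inl]; fun_prop
  · simp only [Sum.elim_inr]; fun_prop

/-- The regression representation of a Gaussian vector whose first coordinate has unit variance: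
it is a linear function of the remaining coordinates plus an independent Gaussian error. -/
theorem multivariateGaussian_fromBlocks_eq_map {n : ℕ} {S : Matrix (Fin n) (Fin n) ℝ}
    (hS : S.PosDef) (b : Fin n → ℝ) {s : ℝ} (hs : s ^ 2 = 1 - b ⬝ᵥ (S⁻¹ *ᵥ b))
    (hJ : (fromBlocks (of fun _ _ => 1) (of fun _ j => b j) (of fun i _ => b i) S :
      Matrix (Unit ⊕ Fin n) (Unit ⊕ Fin n) ℝ).PosSemidef) :
    multivariateGaussian (0 : EuclideanSpace ℝ (Unit ⊕ Fin n))
        (fromBlocks (of fun _ _ => 1) (of fun _ j => b j) (of fun i _ => b i) S) =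
      ((gaussianReal 0 1).prod (multivariateGaussian (0 : EuclideanSpace ℝ (Fin n)) S)).map
        fun p => WithLp.toLp 2
          (Sum.elim (fun _ => b ⬝ᵥ (S⁻¹ *ᵥ WithLp.ofLp p.2) + s * p.1) (WithLp.ofLp p.2)) := by
  have hcont := continuous_regression S b s
  have := Measure.isProbabilityMeasure_map (μ := (gaussianReal 0 1).prod
    (multivariateGaussian (0 : EuclideanSpace ℝ (Fin n)) S)) hcont.measurable.aemeasurable
  have hST : (S⁻¹)ᵀ = S⁻¹ := by
    rw [transpose_nonsing_inv]
    have := hS.isHermitian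
    rw [IsHermitian, conjTranspose_eq_transpose_of_trivial] at this
    rw [this]
  have hSS : ∀ v, S *ᵥ (S⁻¹ *ᵥ v) = v := fun v => by
    rw [mulVec_mulVec, mul_nonsing_inv _ ((isUnit_iff_isUnit_det _).1 hS.isUnit), one_mulVec]
  have hbS : ∀ v, b ⬝ᵥ (S⁻¹ *ᵥ v) = (S⁻¹ *ᵥ b) ⬝ᵥ v := fun v => by
    rw [dotProduct_mulVec, ← mulVec_transpose, hST]
  refine Measure.ext_of_charFun (funext fun t => ?_)
  set a : ℝ := t (.inl ()) with ha
  set u : Fin n → ℝ := fun i => t (.inr i) with hu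
  have ht : WithLp.ofLp t = Sum.elim (fun _ => a) u := by
    ext i
    rcases i with i | i <;> rfl
  -- Completing the square makes the joint characteristic function split into a factor for the error
  -- and a factor for `N(0, S)`.
  have hquad : (WithLp.ofLp t) ⬝ᵥ (fromBlocks (of fun _ _ => 1) (of fun _ j => b j)
      (of fun i _ => b i) S *ᵥ WithLp.ofLp t) =
      (s * a) ^ 2 + (a • (S⁻¹ *ᵥ b) + u) ⬝ᵥ (S *ᵥ (a • (S⁻¹ *ᵥ b) + u)) := by
    have h1 : (of fun (_ : Unit) j => b j) *ᵥ u = fun _ => b ⬝ᵥ u := rfl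
    have h2 : (of fun (i : Fin n) (_ : Unit) => b i) *ᵥ (fun _ => a) = a • b := by
      ext; simp [mulVec, dotProduct, mul_comm]
    have h3 : (S⁻¹ *ᵥ b) ⬝ᵥ (S *ᵥ u) = b ⬝ᵥ u := by
      rw [← hbS, mulVec_mulVec, nonsing_inv_mul _ ((isUnit_iff_isUnit_det _).1 hS.isUnit),
        one_mulVec]
    rw [ht, fromBlocks_mulVec, Sum.elim_comp_inl, Sum.elim_comp_inr, sumElim_dotProduct_sumElim,
      h1, h2]
    simp only [mulVec_add, mulVec_smul, hSS, dotProduct_add, add_dotProduct, smul_dotProduct,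
      dotProduct_smul, h3, smul_eq_mul, dotProduct_comm u b, dotProduct_comm _ b]
    simp [dotProduct, mulVec] at hs ⊢
    linear_combination (-a ^ 2) * hs
  rw [charFun_multivariateGaussian hJ, charFun_apply, integral_map hcont.aemeasurable (by fun_prop)]
  have hinner : ∀ p : ℝ × EuclideanSpace ℝ (Fin n), inner ℝ (WithLp.toLp 2
      (Sum.elim (fun _ : Unit => b ⬝ᵥ (S⁻¹ *ᵥ WithLp.ofLp p.2) + s * p.1) (WithLp.ofLp p.2))) t =
        p.1 * (s * a) + inner ℝ p.2 (WithLp.toLp 2 (a • (S⁻¹ *ᵥ b) + u)) := by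
    intro p
    rw [EuclideanSpace.inner_eq_star_dotProduct, EuclideanSpace.inner_eq_star_dotProduct, ht]
    simp only [star_trivial, sumElim_dotProduct_sumElim, add_dotProduct, smul_dotProduct, hbS]
    simp [dotProduct]
    ring
  simp only [hinner, Complex.ofReal_add, add_mul, Complex.exp_add]
  rw [integral_prod_mul (fun z : ℝ => Complex.exp (((z * (s * a) : ℝ) : ℂ) * Complex.I))
    (fun x : EuclideanSpace ℝ (Fin n) =>
      Complex.exp (((inner ℝ x (WithLp.toLp 2 (a • (S⁻¹ *ᵥ b) + u)) : ℝ) : ℂ) * Complex.I)),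
    ← charFun_apply, charFun_multivariateGaussian hS.posSemidef]
  have h1 : ∫ z : ℝ, Complex.exp (((z * (s * a) : ℝ) : ℂ) * Complex.I) ∂gaussianReal 0 1 =
      charFun (gaussianReal 0 1) (s * a) := by
    rw [charFun_apply_real]
    simp [mul_comm]
  rw [h1, charFun_gaussianReal, ← Complex.exp_add, hquad]
  congr 1
  simp
  ring

/-- Tonelli with `x` held fixed: the section in the error variable is a half-line if `x` lies in its
orthant, and empty otherwise. -/
theorem multivariateGaussian_fromBlocks_apply {n : ℕ} {S : Matrix (Fin n) (Fin n) ℝ}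
    (hS : S.PosDef) (b : Fin n → ℝ) {s : ℝ} (hs0 : 0 < s) (hs : s ^ 2 = 1 - b ⬝ᵥ (S⁻¹ *ᵥ b))
    (hJ : (fromBlocks (of fun _ _ => 1) (of fun _ j => b j) (of fun i _ => b i) S :
      Matrix (Unit ⊕ Fin n) (Unit ⊕ Fin n) ℝ).PosSemidef) (a : EReal) (c : Fin n → EReal) :
    multivariateGaussian (0 : EuclideanSpace ℝ (Unit ⊕ Fin n))
        (fromBlocks (of fun _ _ => 1) (of fun _ j => b j) (of fun i _ => b i) S)
        {x | ∀ i, ((x i : ℝ) : EReal) ≤ Sum.elim (fun _ => a) c i} =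
      ∫⁻ x in {x | ∀ i, ((x i : ℝ) : EReal) ≤ c i}, ENNReal.ofReal (stdNormalCDF
        ((a - ((b ⬝ᵥ (S⁻¹ *ᵥ WithLp.ofLp x) : ℝ) : EReal)) / (s : EReal)))
          ∂multivariateGaussian (0 : EuclideanSpace ℝ (Fin n)) S := by
  have hmeas : ∀ {ι : Type} [Fintype ι] (d : ι → EReal), MeasurableSet
      {x : EuclideanSpace ℝ ι | ∀ i, ((x i : ℝ) : EReal) ≤ d i} := fun d => by
    rw [Set.ofPred_forall]
    exact MeasurableSet.iInter fun i =>
      measurableSet_le (measurable_coe_real_ereal.comp (by fun_prop)) measurable_const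
  have hcont := continuous_regression S b s
  rw [multivariateGaussian_fromBlocks_eq_map hS b hs hJ, Measure.map_apply hcont.measurable
    (hmeas _), Measure.prod_apply_symm (hcont.measurable (hmeas _)),
    ← lintegral_indicator (hmeas _)]
  refine lintegral_congr fun x => ?_
  by_cases hx : x ∈ {x : EuclideanSpace ℝ (Fin n) | ∀ i, ((x i : ℝ) : EReal) ≤ c i}
  · rw [Set.indicator_of_mem hx, stdNormalCDF, ofReal_measureReal]
    congr 1
    ext z
    simp only [Set.mem_preimage, Set.mem_ofPred_eq, coe_le_stdNormalStandardize_iff _ _ hs0,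
      Sum.forall, Sum.elim_inl, Sum.elim_inr]
    exact ⟨fun h => h.1 (), fun h => ⟨fun _ => h, hx⟩⟩
  · rw [Set.indicator_of_notMem hx]
    refine (congrArg _ ?_).trans (measure_empty (μ := gaussianReal 0 1))
    ext z
    simp only [Set.mem_preimage, Set.mem_ofPred_eq, Sum.forall, Sum.elim_inl, Sum.elim_inr,
      Set.mem_empty_iff_false, iff_false, not_and]
    exact fun _ h => hx h

/-! ### Limits in `n`, measurability and nonnegativity of the formulas. -/

open Filter Topology in
theorem tendsto_stdNormalCDF_standardize {F : ℕ → ℝ} (hF : Tendsto F atTop (𝓝 1))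
    (m : ℝ) {s : ℝ} (hs : 0 < s) :
    Tendsto (fun n => stdNormalCDF ((stdNormalQuantile (F n) - (m : EReal)) / (s : EReal)))
      atTop (𝓝 1) := by
  refine tendsto_order.2 ⟨fun a ha => ?_, fun a ha =>
    .of_forall fun n => (stdNormalCDF_le_one _).trans_lt ha⟩
  -- Once `F n` exceeds `Φ(m + s w)`, the standardized quantile is at least `w`. This comparison
  -- avoids any continuity of the quantile at `1`.
  obtain ⟨w, hw⟩ := ((tendsto_cdf_atTop (gaussianReal 0 1)).eventually (lt_mem_nhds ha)).exists
  filter_upwards [hF.eventually (lt_mem_nhds (cdf_gaussianReal_lt_one (m + s * w)))] with n hn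
  rw [← stdNormalCDF_coe] at hw hn
  refine hw.trans_le (stdNormalCDF_mono ?_)
  rw [coe_le_stdNormalStandardize_iff _ _ hs,
    ← stdNormalQuantile_stdNormalCDF ((m + s * w : ℝ) : EReal)]
  exact stdNormalQuantile_mono hn.le

theorem freqCDF_mono {Ω : Type*} [MeasurableSpace Ω] (P : Measure Ω) [IsProbabilityMeasure P]
    (N : Ω → ℤ) : Monotone (freqCDF P N) := fun _ _ h =>
  measureReal_mono fun _ hω => le_trans hω h

open Filter Topology in
theorem tendsto_measure_le_inter {Ω : Type*} [MeasurableSpace Ω] (P : Measure Ω)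
    (N : Ω → ℤ) (B : Set Ω) :
    Tendsto (fun n : ℕ => P ({ω | N ω ≤ n} ∩ B)) atTop (𝓝 (P B)) := by
  have hmono : Monotone fun n : ℕ => {ω | N ω ≤ n} ∩ B := fun i j hij ω hω =>
    ⟨(show N ω ≤ i from hω.1).trans (Int.ofNat_le.2 hij), hω.2⟩
  have hU : ⋃ n : ℕ, {ω | N ω ≤ n} ∩ B = B := by
    rw [← Set.iUnion_inter, Set.iUnion_eq_univ_iff.2 fun ω => ⟨(N ω).toNat, Int.self_le_toNat _⟩,
      Set.univ_inter]
  have h := tendsto_measure_iUnion_atTop (μ := P) hmono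
  rwa [hU] at h

open Filter Topology in
theorem tendsto_freqCDF_atTop {Ω : Type*} [MeasurableSpace Ω] (P : Measure Ω)
    [IsProbabilityMeasure P] (N : Ω → ℤ) :
    Tendsto (fun n : ℕ => freqCDF P N n) atTop (𝓝 1) := by
  have h := tendsto_measure_le_inter P N Set.univ
  simp only [Set.inter_univ, measure_univ] at h
  exact (ENNReal.tendsto_toReal ENNReal.one_ne_top).comp h

theorem severityDensity_nonneg (z : CorrStructure) (k : ℕ) (ρ₂ : ℝ) (F₂ : ℝ → ℝ) {f₂ : ℝ → ℝ}
    (hf : ∀ x, 0 ≤ f₂ x) (y : Fin k → ℝ) : 0 ≤ severityDensity z k ρ₂ F₂ f₂ y :=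
  mul_nonneg (gaussianCopulaDensity_nonneg _ _) (Finset.prod_nonneg fun _ _ => hf _)

theorem measurable_comp_apply {k : ℕ} {F : ℝ → ℝ} (hF : Measurable F) :
    Measurable fun (y : Fin k → ℝ) i => F (y i) :=
  measurable_pi_lambda _ fun i => hF.comp (measurable_pi_apply i)

theorem measurable_severityDensity (z : CorrStructure) (k : ℕ) (ρ₂ : ℝ) {F₂ f₂ : ℝ → ℝ}
    (hF : Measurable F₂) (hf : Measurable f₂) : Measurable (severityDensity z k ρ₂ F₂ f₂) :=
  ((measurable_gaussianCopulaDensity _).comp (measurable_comp_apply hF)).mul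
    (Finset.measurable_prod _ fun i _ => hf.comp (measurable_pi_apply i))

theorem measurable_weighted_sum (z : CorrStructure) (k : ℕ) (ρ₁ ρ₂ : ℝ) :
    Measurable fun x : Fin k → ℝ =>
      (fun _ : Fin k => ρ₁) ⬝ᵥ ((severityCorr z k ρ₂)⁻¹ *ᵥ x) := by
  have : Continuous fun x : Fin k → ℝ =>
    (fun _ : Fin k => ρ₁) ⬝ᵥ ((severityCorr z k ρ₂)⁻¹ *ᵥ x) := by fun_prop
  exact this.measurable

theorem measurable_condMean (z : CorrStructure) (k : ℕ) (ρ₁ ρ₂ : ℝ) {F₂ : ℝ → ℝ}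
    (hF : Measurable F₂) : Measurable (condMean z k ρ₁ ρ₂ F₂) :=
  (measurable_weighted_sum z k ρ₁ ρ₂).comp
    (measurable_quantileVector.comp (measurable_comp_apply hF))

theorem measurable_jointDensity (z : CorrStructure) (k : ℕ) (ρ₁ ρ₂ : ℝ) (F₁ : ℤ → ℝ)
    {F₂ f₂ : ℝ → ℝ} (hF : Measurable F₂) (hf : Measurable f₂) (n : ℤ) :
    Measurable (jointDensity z k ρ₁ ρ₂ F₁ F₂ f₂ n) :=
  (measurable_severityDensity z k ρ₂ hF hf).mul
    (((measurable_stdNormalCDF_standardize _).comp (measurable_condMean z k ρ₁ ρ₂ hF)).sub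
      ((measurable_stdNormalCDF_standardize _).comp (measurable_condMean z k ρ₁ ρ₂ hF)))

theorem jointDensity_nonneg {z : CorrStructure} {k : ℕ} {ρ₁ ρ₂ : ℝ} {F₁ : ℤ → ℝ}
    (hF₁ : Monotone F₁) (F₂ : ℝ → ℝ) {f₂ : ℝ → ℝ} (hf : ∀ x, 0 ≤ f₂ x)
    (hs : 0 < condSD z k ρ₁ ρ₂) (n : ℤ) (y : Fin k → ℝ) :
    0 ≤ jointDensity z k ρ₁ ρ₂ F₁ F₂ f₂ n y :=
  mul_nonneg (severityDensity_nonneg z k ρ₂ F₂ hf y) (sub_nonneg.2 (stdNormalCDF_mono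
    (sub_coe_div_coe_mono _ hs (stdNormalQuantile_mono (hF₁ (by omega))))))

/-! ### Densities in the collective risk model. -/

namespace GaussianConditionalModel

theorem measurable_sev_vector {Ω : Type*} [MeasurableSpace Ω] {P : Measure Ω}
    {z : CorrStructure} {k : ℕ} {ρ₁ ρ₂ : ℝ} {ν₂ : Measure ℝ} {f₂ : ℝ → ℝ} {N : Ω → ℤ}
    {Y : Fin k → Ω → ℝ} (h : GaussianConditionalModel P z k ρ₁ ρ₂ ν₂ f₂ N Y) :
    Measurable fun ω i => Y i ω :=
  measurable_pi_lambda _ h.measurable_sev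

variable {Ω : Type*} [MeasurableSpace Ω] {P : Measure Ω} [IsProbabilityMeasure P]
  {z : CorrStructure} {k : ℕ} {ρ₁ ρ₂ : ℝ} {ν₂ : Measure ℝ} [IsProbabilityMeasure ν₂]
  {f₂ : ℝ → ℝ} {N : Ω → ℤ} {Y : Fin k → Ω → ℝ}

/-- On lower orthants the left side is the given joint distribution function, so regression followed
by the change of variables yields the right side. -/
theorem map_restrict_freq_le (h : GaussianConditionalModel P z k ρ₁ ρ₂ ν₂ f₂ N Y) (n : ℤ) :
    (P.restrict {ω | N ω ≤ n}).map (fun ω i => Y i ω) = volume.withDensity fun y =>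
      ENNReal.ofReal (severityDensity z k ρ₂ (cdf ν₂) f₂ y) *
        ENNReal.ofReal (stdNormalCDF ((stdNormalQuantile (freqCDF P N n) -
          (condMean z k ρ₁ ρ₂ (cdf ν₂) y : EReal)) / (condSD z k ρ₁ ρ₂ : EReal))) := by
  refine measure_pi_ext_of_Iic _ _ fun y => ?_
  have hset : (fun ω i => Y i ω) ⁻¹' Set.Iic y ∩ {ω | N ω ≤ n} =
      {ω | N ω ≤ n ∧ ∀ i, Y i ω ≤ y i} := by
    ext ω; exact and_comm
  have hS := h.admissible.posDef_severityCorr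
  have hsq : condSD z k ρ₁ ρ₂ ^ 2 =
      1 - (fun _ => ρ₁) ⬝ᵥ ((severityCorr z k ρ₂)⁻¹ *ᵥ fun _ => ρ₁) :=
    Real.sq_sqrt h.admissible.condVar_pos.le
  have hset' : {x : EuclideanSpace ℝ (Unit ⊕ Fin k) | ∀ i, ((x i : ℝ) : EReal) ≤
      stdNormalQuantile (Sum.elim (fun _ => freqCDF P N n) (fun i => cdf ν₂ (y i)) i)} =
      {x | ∀ i, ((x i : ℝ) : EReal) ≤ Sum.elim (fun _ => stdNormalQuantile (freqCDF P N n))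
        (fun i => stdNormalQuantile (cdf ν₂ (y i))) i} := by
    ext x; simp [Sum.forall]
  rw [Measure.map_apply h.measurable_sev_vector measurableSet_Iic,
    Measure.restrict_apply (h.measurable_sev_vector measurableSet_Iic), hset,
    ← ofReal_measureReal, h.joint_cdf, gaussianCopula, ofReal_measureReal, hset',
    withDensity_apply _ measurableSet_Iic]
  refine (multivariateGaussian_fromBlocks_apply hS (fun _ => ρ₁) h.admissible.condSD_pos hsq
    h.admissible.posDef_jointCorr.posSemidef _ _).trans ?_
  exact setLIntegral_multivariateGaussian_le_quantile hS ν₂ h.sev_density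
    (W := fun x => ENNReal.ofReal (stdNormalCDF ((stdNormalQuantile (freqCDF P N n) -
      (((fun _ => ρ₁) ⬝ᵥ ((severityCorr z k ρ₂)⁻¹ *ᵥ x) : ℝ) : EReal)) /
        (condSD z k ρ₁ ρ₂ : EReal))))
    (((measurable_stdNormalCDF_standardize _).comp
      (measurable_weighted_sum z k ρ₁ ρ₂)).ennreal_ofReal) y

theorem measure_freq_le_inter (h : GaussianConditionalModel P z k ρ₁ ρ₂ ν₂ f₂ N Y) (n : ℤ)
    {A : Set (Fin k → ℝ)} (hA : MeasurableSet A) :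
    P ({ω | N ω ≤ n} ∩ (fun ω i => Y i ω) ⁻¹' A) = ∫⁻ y in A,
      ENNReal.ofReal (severityDensity z k ρ₂ (cdf ν₂) f₂ y) *
        ENNReal.ofReal (stdNormalCDF ((stdNormalQuantile (freqCDF P N n) -
          (condMean z k ρ₁ ρ₂ (cdf ν₂) y : EReal)) / (condSD z k ρ₁ ρ₂ : EReal))) := by
  rw [← withDensity_apply _ hA, ← h.map_restrict_freq_le n,
    Measure.map_apply h.measurable_sev_vector hA,
    Measure.restrict_apply (h.measurable_sev_vector hA), Set.inter_comm]

/-- Let `n → ∞`: the events `N ≤ n` exhaust the space, and the `Φ` factor increases to `1`, so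
monotone convergence applies. -/
theorem hasDensity_sev (h : GaussianConditionalModel P z k ρ₁ ρ₂ ν₂ f₂ N Y) :
    HasDensity (P.map fun ω i => Y i ω) volume (severityDensity z k ρ₂ (cdf ν₂) f₂) := by
  have hF := (monotone_cdf ν₂).measurable
  have hm := measurable_severityDensity z k ρ₂ hF h.sev_density.measurable
  refine ⟨hm, severityDensity_nonneg z k ρ₂ _ h.sev_density.nonneg, ?_⟩
  ext A hA
  rw [Measure.map_apply h.measurable_sev_vector hA, withDensity_apply _ hA]
  refine tendsto_nhds_unique (tendsto_measure_le_inter P N _) ?_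
  simp only [h.measure_freq_le_inter _ hA]
  refine lintegral_tendsto_of_tendsto_of_monotone (fun n => ?_) (.of_forall fun y i j hij => ?_)
    (.of_forall fun y => ?_)
  · exact (hm.ennreal_ofReal.mul ((measurable_stdNormalCDF_standardize _).comp
      (measurable_condMean z k ρ₁ ρ₂ hF)).ennreal_ofReal).aemeasurable
  · exact mul_le_mul_right (ENNReal.ofReal_le_ofReal (stdNormalCDF_mono
      (sub_coe_div_coe_mono _ h.admissible.condSD_pos (stdNormalQuantile_mono
        (freqCDF_mono P N (by exact_mod_cast hij)))))) _
  · have h1 := ENNReal.tendsto_ofReal (tendsto_stdNormalCDF_standardize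
      (tendsto_freqCDF_atTop P N) (condMean z k ρ₁ ρ₂ (cdf ν₂) y) h.admissible.condSD_pos)
    have h2 := ENNReal.Tendsto.const_mul
      (a := ENNReal.ofReal (severityDensity z k ρ₂ (cdf ν₂) f₂ y)) h1
      (.inr ENNReal.ofReal_ne_top)
    simpa using h2

/-- With weight `W = 1`, the change of variables expresses the copula through the density already
found for `Y`. -/
theorem cdf_sev (h : GaussianConditionalModel P z k ρ₁ ρ₂ ν₂ f₂ N Y) (y : Fin k → ℝ) :
    P.real {ω | ∀ i, Y i ω ≤ y i} =
      gaussianCopula (severityCorr z k ρ₂) fun i => cdf ν₂ (y i) := by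
  have h1 := setLIntegral_multivariateGaussian_le_quantile h.admissible.posDef_severityCorr ν₂
    h.sev_density (W := fun _ => 1) measurable_const y
  simp only [mul_one, setLIntegral_one] at h1
  rw [gaussianCopula, measureReal_def, measureReal_def, h1]
  congr 1
  refine Eq.trans ?_ (withDensity_apply _ measurableSet_Iic)
  have h2 := h.hasDensity_sev.eq_withDensity
  unfold severityDensity at h2
  rw [← h2, Measure.map_apply h.measurable_sev_vector measurableSet_Iic]
  rfl

theorem measure_freq_eq_inter (h : GaussianConditionalModel P z k ρ₁ ρ₂ ν₂ f₂ N Y) (n : ℤ)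
    {A : Set (Fin k → ℝ)} (hA : MeasurableSet A) :
    P ({ω | N ω = n} ∩ (fun ω i => Y i ω) ⁻¹' A) = ∫⁻ y in A,
      ENNReal.ofReal (jointDensity z k ρ₁ ρ₂ (freqCDF P N) (cdf ν₂) f₂ n y) := by
  have hF := (monotone_cdf ν₂).measurable
  have hsplit : P ({ω | N ω ≤ n} ∩ (fun ω i => Y i ω) ⁻¹' A) =
      P ({ω | N ω = n} ∩ (fun ω i => Y i ω) ⁻¹' A) +
        P ({ω | N ω ≤ n - 1} ∩ (fun ω i => Y i ω) ⁻¹' A) := by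
    rw [← measure_union]
    · congr 1
      ext ω
      simp only [Set.mem_inter_iff, Set.mem_union, Set.mem_ofPred_eq, ← or_and_right]
      exact and_congr_left fun _ => by omega
    · refine Set.disjoint_left.2 fun ω h1 h2 => ?_
      have h3 : N ω = n := h1.1
      have h4 : N ω ≤ n - 1 := h2.1
      omega
    · exact (measurableSet_le h.measurable_freq measurable_const).inter
        (h.measurable_sev_vector hA)
  -- The difference of the formulas at `n` and `n - 1` is taken as an addition with a finite term
  -- cancelled, since subtraction in `ENNReal` truncates.
  have hne : P ({ω | N ω ≤ n - 1} ∩ (fun ω i => Y i ω) ⁻¹' A) ≠ ⊤ := measure_ne_top _ _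
  refine (ENNReal.add_left_inj hne).1 ?_
  rw [← hsplit, h.measure_freq_le_inter n hA, h.measure_freq_le_inter (n - 1) hA,
    ← lintegral_add_left (measurable_jointDensity z k ρ₁ ρ₂ (freqCDF P N) hF
      h.sev_density.measurable n).ennreal_ofReal]
  refine lintegral_congr fun y => ?_
  have h0 := severityDensity_nonneg z k ρ₂ (cdf ν₂) h.sev_density.nonneg y
  rw [← ENNReal.ofReal_mul h0, ← ENNReal.ofReal_mul h0, ← ENNReal.ofReal_add
    (jointDensity_nonneg (freqCDF_mono P N) _ h.sev_density.nonneg h.admissible.condSD_pos n y)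
    (mul_nonneg h0 (stdNormalCDF_nonneg _)), jointDensity]
  congr 1
  ring

theorem hasDensity_joint (h : GaussianConditionalModel P z k ρ₁ ρ₂ ν₂ f₂ N Y) :
    HasDensity (P.map fun ω => (N ω, fun i => Y i ω))
      ((Measure.count : Measure ℤ).prod (volume : Measure (Fin k → ℝ)))
      (fun p => jointDensity z k ρ₁ ρ₂ (freqCDF P N) (cdf ν₂) f₂ p.1 p.2) := by
  have hF := (monotone_cdf ν₂).measurable
  have hm : Measurable fun p : ℤ × (Fin k → ℝ) =>
      jointDensity z k ρ₁ ρ₂ (freqCDF P N) (cdf ν₂) f₂ p.1 p.2 :=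
    measurable_from_prod_countable_right fun n =>
      measurable_jointDensity z k ρ₁ ρ₂ _ hF h.sev_density.measurable n
  refine ⟨hm, fun p => jointDensity_nonneg (freqCDF_mono P N) _ h.sev_density.nonneg
    h.admissible.condSD_pos _ _, ?_⟩
  ext s hs
  have hsec : ∀ n : ℤ, MeasurableSet {y : Fin k → ℝ | (n, y) ∈ s} := fun n =>
    measurable_prodMk_left hs
  -- Slicing along the countable frequency axis reduces the joint law to the events `N = n`.
  have hset : (fun ω => (N ω, fun i => Y i ω)) ⁻¹' s =
      ⋃ n : ℤ, {ω | N ω = n} ∩ (fun ω i => Y i ω) ⁻¹' {y | (n, y) ∈ s} := by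
    ext ω
    simp
  rw [Measure.map_apply (h.measurable_freq.prodMk h.measurable_sev_vector) hs, hset,
    measure_iUnion, withDensity_apply _ hs, ← lintegral_indicator hs, lintegral_prod _
      (hm.ennreal_ofReal.indicator hs).aemeasurable, lintegral_count]
  · refine tsum_congr fun n => ?_
    rw [h.measure_freq_eq_inter n (hsec n), ← lintegral_indicator (hsec n)]
    rfl
  · refine fun m n hmn => Set.disjoint_left.2 fun ω h1 h2 => hmn ?_
    exact (h1.1 : N ω = m).symm.trans h2.1
  · exact fun n => (measurableSet_eq_fun h.measurable_freq measurable_const).inter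
      (h.measurable_sev_vector (hsec n))

theorem hasDensity_cond (h : GaussianConditionalModel P z k ρ₁ ρ₂ ν₂ f₂ N Y) (n : ℤ)
    (hn : 0 < freqPMF P N n) :
    HasDensity ((ProbabilityTheory.cond P {ω | N ω = n}).map fun ω i => Y i ω) volume
      (fun y => jointDensity z k ρ₁ ρ₂ (freqCDF P N) (cdf ν₂) f₂ n y / freqPMF P N n) := by
  have hm := measurable_jointDensity z k ρ₁ ρ₂ (freqCDF P N) (monotone_cdf ν₂).measurable
    h.sev_density.measurable n
  refine ⟨hm.div_const _, fun y => div_nonneg (jointDensity_nonneg (freqCDF_mono P N) _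
    h.sev_density.nonneg h.admissible.condSD_pos _ _) hn.le, ?_⟩
  ext A hA
  rw [Measure.map_apply h.measurable_sev_vector hA, withDensity_apply _ hA,
    cond_apply (measurableSet_eq_fun h.measurable_freq measurable_const),
    h.measure_freq_eq_inter n hA, ← lintegral_const_mul _ hm.ennreal_ofReal]
  refine lintegral_congr fun y => ?_
  rw [ENNReal.ofReal_div_of_pos hn, freqPMF, ofReal_measureReal, ENNReal.div_eq_inv_mul]

end GaussianConditionalModel

theorem lemma1 {Ω : Type*} [MeasurableSpace Ω] (P : Measure Ω) [IsProbabilityMeasure P]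
    (z : CorrStructure) (k : ℕ) (hk : 0 < k) (ρ₁ ρ₂ : ℝ)
    (ν₂ : Measure ℝ) [IsProbabilityMeasure ν₂] (f₂ : ℝ → ℝ)
    (N : Ω → ℤ) (Y : Fin k → Ω → ℝ)
    (hmodel : GaussianConditionalModel P z k ρ₁ ρ₂ ν₂ f₂ N Y) :
    -- the inverse matrix and the quotients by `σ` in the formulas are meaningful
    ((severityCorr z k ρ₂).PosDef ∧ 0 < condSD z k ρ₁ ρ₂) ∧
    -- `f_Y` is the density of the law of `Y`, whose distribution function is `C(F₂, …, F₂)`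
    (HasDensity (P.map fun ω i => Y i ω) volume (severityDensity z k ρ₂ (cdf ν₂) f₂) ∧
      ∀ y : Fin k → ℝ, P.real {ω | ∀ i, Y i ω ≤ y i} =
        gaussianCopula (severityCorr z k ρ₂) fun i => cdf ν₂ (y i)) ∧
    -- the joint density of `(N, Y)`, discrete in `n` and continuous in `y`
    HasDensity (P.map fun ω => (N ω, fun i => Y i ω))
      ((Measure.count : Measure ℤ).prod (volume : Measure (Fin k → ℝ)))
      (fun p => jointDensity z k ρ₁ ρ₂ (freqCDF P N) (cdf ν₂) f₂ p.1 p.2) ∧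
    -- the conditional density of `Y` given `N = n`
    ∀ n : ℤ, 0 < freqPMF P N n →
      HasDensity ((ProbabilityTheory.cond P {ω | N ω = n}).map fun ω i => Y i ω) volume
        (fun y => jointDensity z k ρ₁ ρ₂ (freqCDF P N) (cdf ν₂) f₂ n y / freqPMF P N n) := by
  exact ⟨⟨hmodel.admissible.posDef_severityCorr, hmodel.admissible.condSD_pos⟩,
    ⟨hmodel.hasDensity_sev, hmodel.cdf_sev⟩, hmodel.hasDensity_joint, hmodel.hasDensity_cond⟩
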